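/- Let $k\ge 2$ be an integer. Consider sequences $A=(A_1,\dots,A_n)$ of length $n$ with entries in $\{1,\dots,n\}$ in which every value occurs at most $k$ times. Call an integer sequence $k$-occurrence-free if no integer occurs exactly $k$ times in it, and call $A$ $\varepsilon$-far from $k$-occurrence-free if more than $\varepsilon n$ entries of $A$ have to be changed (to arbitrary integers) to obtain a $k$-occurrence-free sequence. An $\varepsilon$-tester for $k$-occurrence-freeness on length $n$ is a randomized, adaptive algorithm that queries the values of $A$ at positions of its choice and that, with probability at least $2/3$, accepts every such $A$ that is $k$-occurrence-free and, with probability at least $2/3$, rejects every such $A$ that is $\varepsilon$-far from $k$-occurrence-free; its query complexity is the largest number of queries that it makes on any such $A$ and for any outcome of its randomness. Then there are constants $\varepsilon_0>0$, $c>0$ and $n_0$, depending only on $k$, such that for all $n\ge n_0$ and all $0<\varepsilon\le\varepsilon_0$, every $\varepsilon$-tester for $k$-occurrence-freeness on length $n$ has query complexity at least $c\,n^{1-1/k}$. In other words, for a proximity parameter $\varepsilon=\Omega_k(1)$, testing $k$-occurrence-freeness requires $\Omega(n^{1-1/k})$ queries. -/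

import Mathlib

open MeasureTheory

namespace SequenceTesting

/-- The number of positions of the integer sequence `A` at which the value `v` occurs. -/
def occ {n : ℕ} (A : Fin n → ℤ) (v : ℤ) : ℕ :=
  (Finset.univ.filter (fun i => A i = v)).card

/-- The admissible inputs of length `n`: every entry lies in `{1, …, n}` and every value occurs
at most `k` times. -/
def IsInput (k : ℕ) {n : ℕ} (A : Fin n → ℤ) : Prop :=
  (∀ i, 1 ≤ A i ∧ A i ≤ (n : ℤ)) ∧ ∀ v : ℤ, occ A v ≤ k

/-- `A` is `k`-occurrence-free: no integer occurs exactly `k` times in `A`. -/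
def OccurrenceFree (k : ℕ) {n : ℕ} (A : Fin n → ℤ) : Prop :=
  ∀ v : ℤ, occ A v ≠ k

/-- `A` is `ε`-far from being `k`-occurrence-free: more than `ε n` entries of `A` have to be
changed (to arbitrary integers) to obtain a `k`-occurrence-free sequence. -/
def IsFar (k : ℕ) (ε : ℝ) {n : ℕ} (A : Fin n → ℤ) : Prop :=
  ∀ B : Fin n → ℤ, OccurrenceFree k B → ε * (n : ℝ) < (hammingDist A B : ℝ)

/-- A deterministic adaptive query algorithm on sequences of length `n`, as a decision tree: it
either stops with an answer (`true` means accept), or queries the value at a position and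
continues in a way that depends on that value. -/
inductive QueryTree (n : ℕ) : Type
  | answer (b : Bool) : QueryTree n
  | query (i : Fin n) (next : ℤ → QueryTree n) : QueryTree n

/-- The answer of a deterministic query algorithm on input `A`. -/
def QueryTree.eval {n : ℕ} (A : Fin n → ℤ) : QueryTree n → Bool
  | .answer b => b
  | .query i next => (next (A i)).eval A

/-- The number of queries that a deterministic query algorithm makes on input `A`. -/
def QueryTree.queries {n : ℕ} (A : Fin n → ℤ) : QueryTree n → ℕ
  | .answer _ => 0
  | .query i next => (next (A i)).queries A + 1

/-- A randomized query algorithm on sequences of length `n` with random seed in `Ω`: each seed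
determines a deterministic query algorithm, and acceptance of a given input is an event. -/
structure RandomizedAlgorithm (n : ℕ) (Ω : Type*) [MeasurableSpace Ω] where
  /-- the deterministic algorithm that is run on a given seed -/
  tree : Ω → QueryTree n
  measurableSet_accept : ∀ A : Fin n → ℤ, MeasurableSet {ω | (tree ω).eval A = true}

/-- The algorithm `T`, whose seed has law `μ`, is an `ε`-tester (with two-sided error) for
`k`-occurrence-freeness of sequences of length `n`: among the admissible inputs it accepts every
`k`-occurrence-free one, and rejects every one that is `ε`-far from `k`-occurrence-free, with
probability at least `2/3`. -/
def IsTester (k : ℕ) (ε : ℝ) {n : ℕ} {Ω : Type*} [MeasurableSpace Ω] (μ : Measure Ω)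
    (T : RandomizedAlgorithm n Ω) : Prop :=
  (∀ A : Fin n → ℤ, IsInput k A → OccurrenceFree k A →
      2 / 3 ≤ μ.real {ω | (T.tree ω).eval A = true}) ∧
  (∀ A : Fin n → ℤ, IsInput k A → IsFar k ε A →
      2 / 3 ≤ μ.real {ω | (T.tree ω).eval A = false})

/-- On every admissible input and for every seed, `T` makes at most `q` queries. -/
def MakesAtMost (k : ℕ) {n : ℕ} {Ω : Type*} [MeasurableSpace Ω]
    (T : RandomizedAlgorithm n Ω) (q : ℕ) : Prop :=
  ∀ A : Fin n → ℤ, IsInput k A → ∀ ω : Ω, (T.tree ω).queries A ≤ q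

end SequenceTesting

/-! Both kinds of hard input consist of blocks of `k` cells, one for each role `j : ZMod k`. The
cells of a block hold values `w_j : ZMod k`, made distinct from those of other blocks by a tag. If
the `w_j` add up to `1` they are not all equal, as `k * w = 0 ≠ 1`, so no value occurs `k` times; if
they add up to `0` the block may be constant, and then a value occurs `k` times. Fewer than `k` cells
of a block do not reveal which of the two is the case.

The blocks are gathered in superblocks of bounded size: the superblock `s` has a block for every
function `r : ZMod k → ZMod k` with sum zero, all shifted by a common hidden function `u s` with
sum zero. For sum `0` exactly `k` of these blocks are constant, whatever `u s` is, so *every*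
such input is far from `k`-occurrence-free (`isFar_hardInput_zero`). The positions are permuted by
a uniformly random bijection `π`.

As long as an algorithm misses a role `j` in every superblock, moving a unit of `u s` between the
roles `j` and `0` turns a run on a sum-`1` input into the same run on a sum-`0` input. This map is
injective on the pairs `(π, u)`, so the acceptance probabilities differ by at most the probability
that all roles of some superblock are reached (`card_accept_one_le`). Since `π` is uniform,
adaptivity does not help: `k` given cells are all found by `q ≤ n - b` queries with probability
at most `(q / b) ^ k` (`card_hitting_le`, by induction on the decision tree), and a union bound over
the `O(n)` choices of cells gives `O(q ^ k / n ^ (k - 1))`. A tester needs this to be at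
least `1 / 3`. -/

namespace SequenceTesting

/-! ### The positions queried on a given input -/

namespace QueryTree

/-- The set of positions that a deterministic query algorithm queries on input `A`. -/
def queried {n : ℕ} (A : Fin n → ℤ) : QueryTree n → Finset (Fin n)
  | .answer _ => ∅
  | .query i next => insert i ((next (A i)).queried A)

/-- The run on `A` only depends on the entries of `A` that it queries. -/
lemma eval_and_queried_congr {n : ℕ} {A B : Fin n → ℤ} (T : QueryTree n)
    (h : ∀ i ∈ T.queried A, A i = B i) :
    T.eval A = T.eval B ∧ T.queried A = T.queried B := by
  induction T with
  | answer b => exact ⟨rfl, rfl⟩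
  | query i next ih =>
    have hi : A i = B i := h i (by simp [queried])
    have := ih (A i) (fun j hj => h j (by simp [queried, hj]))
    simp only [eval, queried]
    rw [← hi]
    exact ⟨this.1, by rw [this.2]⟩

end QueryTree

/-! ### Adaptive queries to a uniformly random bijection -/

section Hitting

variable {n : ℕ} {C : Type*} [Fintype C] [DecidableEq C]

/-- The bijections that agree with `p` on `D`: the event that the positions in `D` have been
exposed, with outcome `p`. -/
def extensions (D : Finset (Fin n)) (p : Fin n → C) : Finset (Fin n ≃ C) :=
  Finset.univ.filter (fun π => ∀ j ∈ D, π j = p j)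

lemma mem_extensions {D : Finset (Fin n)} {p : Fin n → C} {π : Fin n ≃ C} :
    π ∈ extensions D p ↔ ∀ j ∈ D, π j = p j := by
  simp [extensions]

lemma mem_extensions_insert_update {D : Finset (Fin n)} {p : Fin n → C} {i : Fin n} (hi : i ∉ D)
    {v : C} {π : Fin n ≃ C} :
    π ∈ extensions (insert i D) (Function.update p i v) ↔ π ∈ extensions D p ∧ π i = v := by
  simp only [mem_extensions, Finset.forall_mem_insert, Function.update_self]
  rw [and_comm]
  refine and_congr_left fun _ => forall₂_congr fun j hj => ?_
  rw [Function.update_of_ne (by rintro rfl; exact hi hj)]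

lemma card_extensions_filter_eq_sum (D : Finset (Fin n)) (p : Fin n → C) {i : Fin n} (hi : i ∉ D)
    (P : (Fin n ≃ C) → Prop) [DecidablePred P] :
    ((extensions D p).filter P).card =
      ∑ v, ((extensions (insert i D) (Function.update p i v)).filter P).card := by
  rw [Finset.card_eq_sum_card_fiberwise (f := fun π : Fin n ≃ C => π i) (t := Finset.univ)
    (fun _ _ => by simp)]
  refine Finset.sum_congr rfl fun v _ => congrArg _ ?_
  ext π
  simp only [Finset.mem_filter, mem_extensions_insert_update hi]
  tauto

lemma card_extensions_update_le {D : Finset (Fin n)} {p : Fin n → C} {i : Fin n} (hi : i ∉ D)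
    {x y : C} (hx : x ∉ D.image p) (hy : y ∉ D.image p) :
    (extensions (insert i D) (Function.update p i x)).card ≤
      (extensions (insert i D) (Function.update p i y)).card := by
  refine Finset.card_le_card_of_injOn (fun π => π.trans (Equiv.swap x y)) (fun π hπ => ?_)
    (fun π _ ρ _ h => ?_)
  · rw [Finset.mem_coe, mem_extensions_insert_update hi, mem_extensions] at hπ ⊢
    refine ⟨fun j hj => ?_, by simp [hπ.2]⟩
    rw [Equiv.trans_apply, hπ.1 j hj]
    exact Equiv.swap_apply_of_ne_of_ne
      (fun h => hx (Finset.mem_image.2 ⟨j, hj, h⟩)) (fun h => hy (Finset.mem_image.2 ⟨j, hj, h⟩))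
  · ext j
    simpa using congrArg (fun σ : Fin n ≃ C => σ j) h

/-- Conditionally on the exposed positions `D`, an unexposed position is sent to a given
element with probability at most `1 / (n - |D|)`. -/
lemma mul_card_extensions_update_le (hC : Fintype.card C = n) {m : ℕ} {D : Finset (Fin n)}
    (hm : m + D.card ≤ n) {p : Fin n → C} {i : Fin n} (hi : i ∉ D) {x : C}
    (hx : x ∉ D.image p) :
    m * (extensions (insert i D) (Function.update p i x)).card ≤ (extensions D p).card := by
  have hsum := card_extensions_filter_eq_sum D p hi (fun _ => True)
  simp only [Finset.filter_true] at hsum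
  have hcard : m ≤ (D.image p)ᶜ.card := by
    rw [Finset.card_compl, hC]
    have := Finset.card_image_le (s := D) (f := p)
    omega
  calc m * (extensions (insert i D) (Function.update p i x)).card
      ≤ (D.image p)ᶜ.card * (extensions (insert i D) (Function.update p i x)).card := by gcongr
    _ = ∑ _y ∈ (D.image p)ᶜ, (extensions (insert i D) (Function.update p i x)).card := by simp
    _ ≤ ∑ y ∈ (D.image p)ᶜ, (extensions (insert i D) (Function.update p i y)).card :=
        Finset.sum_le_sum fun y hy =>
          card_extensions_update_le hi hx (Finset.mem_compl.1 hy)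
    _ ≤ (extensions D p).card := by
        rw [hsum]
        exact Finset.sum_le_sum_of_subset (Finset.subset_univ _)

lemma succ_mul_pow_add_pow_le (r l : ℕ) : (l + 1) * r ^ l + r ^ (l + 1) ≤ (r + 1) ^ (l + 1) := by
  induction l with
  | zero => simp [add_comm]
  | succ l ih =>
    calc (l + 1 + 1) * r ^ (l + 1) + r ^ (l + 1 + 1)
        ≤ ((l + 1) * r ^ l + r ^ (l + 1)) * (r + 1) := by ring_nf; omega
      _ ≤ (r + 1) ^ (l + 1) * (r + 1) := by gcongr
      _ = _ := (pow_succ _ _).symm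

/-- A query algorithm that reads `a ∘ π` for a uniformly random bijection `π` and makes at most
`r` further queries finds all elements of a given unexposed set `X` with probability at most
`(r / m) ^ |X|`, where at least `m` elements are still unexposed after those queries. -/
lemma card_hitting_le (hC : Fintype.card C = n) (a : C → ℤ) (m : ℕ) (T : QueryTree n) :
    ∀ (D : Finset (Fin n)) (p : Fin n → C) (X : Finset C) (r : ℕ), Disjoint X (D.image p) →
      m + D.card + r ≤ n → (∀ π ∈ extensions D p, T.queries (a ∘ π) ≤ r) →
      ((extensions D p).filter (fun π : Fin n ≃ C => X ⊆ (T.queried (a ∘ π)).image π)).card *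
          m ^ X.card ≤
        r ^ X.card * (extensions D p).card := by
  induction T with
  | answer b =>
    intro D p X r _ _ _
    rcases X.eq_empty_or_nonempty with rfl | hX
    · simp
    · simp [QueryTree.queried, Finset.subset_empty, hX.ne_empty]
  | query i next ih =>
    intro D p X r hX hm hq
    rcases X.eq_empty_or_nonempty with rfl | hXne
    · simp
    rcases (extensions D p).eq_empty_or_nonempty with hE | ⟨π₀, hπ₀⟩
    · simp [hE]
    obtain ⟨r, rfl⟩ : ∃ r', r = r' + 1 := by
      have := hq π₀ hπ₀
      simp only [QueryTree.queries] at this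
      exact ⟨r - 1, by omega⟩
    by_cases hi : i ∈ D
    · have hpi : p i ∉ X := fun h =>
        Finset.disjoint_left.1 hX h (Finset.mem_image_of_mem p hi)
      have hrun : ∀ π ∈ extensions D p, next ((a ∘ π) i) = next (a (p i)) := fun π hπ => by
        rw [Function.comp_apply, mem_extensions.1 hπ i hi]
      have key := ih (a (p i)) D p X r hX (by omega) (fun π hπ => by
        have := hq π hπ
        simp only [QueryTree.queries, hrun π hπ] at this
        omega)
      have hfilter : (extensions D p).filter
            (fun π : Fin n ≃ C => X ⊆ ((QueryTree.query i next).queried (a ∘ π)).image π) =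
          (extensions D p).filter
            (fun π : Fin n ≃ C => X ⊆ ((next (a (p i))).queried (a ∘ π)).image π) := by
        refine Finset.filter_congr fun π hπ => ?_
        simp only [QueryTree.queried, hrun π hπ, Finset.image_insert]
        rw [Finset.subset_insert_iff_of_notMem (by rwa [mem_extensions.1 hπ i hi])]
      rw [hfilter]
      refine key.trans ?_
      gcongr
      omega
    · obtain ⟨l, hl⟩ : ∃ l, X.card = l + 1 := ⟨X.card - 1, by have := hXne.card_pos; omega⟩
      have hdisj : ∀ v, (insert i D).image (Function.update p i v) = insert v (D.image p) := by
        intro v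
        rw [Finset.image_insert, Function.update_self]
        congr 1
        refine Finset.image_congr fun j hj => Function.update_of_ne ?_ _ _
        rintro rfl
        exact hi hj
      have hcardD : (insert i D).card = D.card + 1 := Finset.card_insert_of_notMem hi
      set E : C → Finset (Fin n ≃ C) :=
        fun v => extensions (insert i D) (Function.update p i v) with hEdef
      have hmemE : ∀ {v π}, π ∈ E v ↔ π ∈ extensions D p ∧ π i = v :=
        mem_extensions_insert_update hi
      have hrun : ∀ v, ∀ π ∈ E v, next ((a ∘ π) i) = next (a v) := fun v π hπ => by
        rw [Function.comp_apply, (hmemE.1 hπ).2]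
      have hqv : ∀ v, ∀ π ∈ E v, (next (a v)).queries (a ∘ π) ≤ r := fun v π hπ => by
        have := hq π (hmemE.1 hπ).1
        simp only [QueryTree.queries, hrun v π hπ] at this
        omega
      -- The number of bijections in `E v` for which the run hits `X`.
      set N : C → ℕ := fun v =>
        ((E v).filter (fun π : Fin n ≃ C =>
          X ⊆ ((QueryTree.query i next).queried (a ∘ π)).image π)).card
        with hN
      have hfilter : ∀ v, N v =
          ((E v).filter (fun π : Fin n ≃ C =>
            X.erase v ⊆ ((next (a v)).queried (a ∘ π)).image π)).card := by
        intro v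
        refine congrArg Finset.card (Finset.filter_congr fun π hπ => ?_)
        simp only [QueryTree.queried, hrun v π hπ, Finset.image_insert, (hmemE.1 hπ).2]
        rw [Finset.subset_insert_iff]
      have hmiss : ∀ v ∉ X, N v * m ^ (l + 1) ≤ r ^ (l + 1) * (E v).card := fun v hv => by
        have := ih (a v) (insert i D) (Function.update p i v) X r
          (by rw [hdisj, Finset.disjoint_insert_right]; exact ⟨hv, hX⟩) (by omega) (hqv v)
        rw [hfilter, Finset.erase_eq_of_notMem hv, ← hl]
        exact this
      have hhit : ∀ v ∈ X, N v * m ^ (l + 1) ≤ r ^ l * (extensions D p).card := fun v hv => by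
        have hvp : v ∉ D.image p := Finset.disjoint_left.1 hX hv
        have := ih (a v) (insert i D) (Function.update p i v) (X.erase v) r
          (by
            rw [hdisj, Finset.disjoint_insert_right]
            exact ⟨Finset.notMem_erase v X, hX.mono_left (Finset.erase_subset _ _)⟩)
          (by omega) (hqv v)
        rw [Finset.card_erase_of_mem hv, hl, Nat.add_sub_cancel] at this
        rw [hfilter, pow_succ, ← mul_assoc]
        calc _ ≤ r ^ l * (E v).card * m := Nat.mul_le_mul_right _ this
          _ = r ^ l * (m * (E v).card) := by ring
          _ ≤ _ := Nat.mul_le_mul_left _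
              (mul_card_extensions_update_le hC (by omega) hi hvp)
      have hEsum : ∑ v, (E v).card = (extensions D p).card := by
        have := card_extensions_filter_eq_sum D p hi (fun _ => True)
        simp only [Finset.filter_true] at this
        exact this.symm
      rw [card_extensions_filter_eq_sum D p hi, hl, Finset.sum_mul]
      calc ∑ v, N v * m ^ (l + 1)
          = ∑ v ∈ X, N v * m ^ (l + 1) + ∑ v ∈ Xᶜ, N v * m ^ (l + 1) :=
            (Finset.sum_add_sum_compl X _).symm
        _ ≤ ∑ _v ∈ X, r ^ l * (extensions D p).card + ∑ v ∈ Xᶜ, r ^ (l + 1) * (E v).card :=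
            add_le_add (Finset.sum_le_sum hhit)
              (Finset.sum_le_sum fun v hv => hmiss v (Finset.mem_compl.1 hv))
        _ ≤ (l + 1) * r ^ l * (extensions D p).card + r ^ (l + 1) * (extensions D p).card := by
            refine add_le_add ?_ ?_
            · simp [hl, mul_assoc]
            · rw [← Finset.mul_sum, ← hEsum]
              exact Nat.mul_le_mul_left _ (Finset.sum_le_sum_of_subset (Finset.subset_univ _))
        _ = ((l + 1) * r ^ l + r ^ (l + 1)) * (extensions D p).card := by ring
        _ ≤ (r + 1) ^ (l + 1) * (extensions D p).card :=
            Nat.mul_le_mul_right _ (succ_mul_pow_add_pow_le r l)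

end Hitting

/-! ### The hard inputs -/

section HardInputs

variable {k : ℕ} [NeZero k] {n m t : ℕ}

/-- The functions `ZMod k → ZMod k` with sum zero. -/
abbrev ZeroSum (k : ℕ) [NeZero k] : Type := {r : ZMod k → ZMod k // ∑ j, r j = 0}

/-- Index type for both the positions and the values of a hard input. A position
`(s, r, j)` is the cell with role `j` in the block `r` of the superblock `s`; the values used in
that block are the `(s, r, w)`. The `t` further cells make the total equal to the input length. -/
abbrev Cell (k : ℕ) [NeZero k] (m t : ℕ) : Type := (Fin m × ZeroSum k × ZMod k) ⊕ Fin t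

instance : DecidableEq (Cell k m t) := instDecidableEqSum

/-- The value held by a cell, where the superblock `s` is shifted by `u s`. The values `w` in any
block add up to `δ`: a block can be constant for `δ = 0`, but not for `δ = 1`. -/
def cellValue (δ : ZMod k) (u : Fin m → ZeroSum k) : Cell k m t → Cell k m t
  | .inl (s, r, j) => .inl (s, r, r.1 j + (u s).1 j + if j = 0 then δ else 0)
  | .inr x => .inr x

/-- An enumeration of the cells by `1, …, n`. -/
def label (e : Cell k m t ≃ Fin n) (c : Cell k m t) : ℤ := (e c : ℤ) + 1

lemma label_injective (e : Cell k m t ≃ Fin n) : Function.Injective (label e) := by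
  intro c d h
  apply e.injective
  apply Fin.ext
  simpa [label] using h

/-- The sequence whose position `i` is the cell `π i`. -/
def hardInput (e : Cell k m t ≃ Fin n) (δ : ZMod k) (π : Fin n ≃ Cell k m t)
    (u : Fin m → ZeroSum k) : Fin n → ℤ :=
  (label e ∘ cellValue δ u) ∘ π

lemma occ_hardInput_label (e : Cell k m t ≃ Fin n) (δ : ZMod k) (π : Fin n ≃ Cell k m t)
    (u : Fin m → ZeroSum k) (c : Cell k m t) :
    occ (hardInput e δ π u) (label e c) =
      (Finset.univ.filter (fun x => cellValue δ u x = c)).card := by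
  refine Finset.card_equiv π fun i => ?_
  simp [hardInput, (label_injective e).eq_iff]

lemma occ_hardInput_of_notMem_range (e : Cell k m t ≃ Fin n) (δ : ZMod k)
    (π : Fin n ≃ Cell k m t) (u : Fin m → ZeroSum k) {v : ℤ} (hv : v ∉ Set.range (label e)) :
    occ (hardInput e δ π u) v = 0 := by
  rw [occ, Finset.card_eq_zero, Finset.filter_eq_empty_iff]
  exact fun i _ h => hv ⟨_, h⟩

lemma card_cellValue_eq_inl (δ : ZMod k) (u : Fin m → ZeroSum k) (s : Fin m) (r : ZeroSum k)
    (w : ZMod k) :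
    (Finset.univ.filter (fun x : Cell k m t => cellValue δ u x = .inl (s, r, w))).card =
      (Finset.univ.filter
        (fun j : ZMod k => r.1 j + (u s).1 j + (if j = 0 then δ else 0) = w)).card := by
  symm
  refine Finset.card_bij (fun j _ => .inl (s, r, j)) (fun j hj => ?_) (fun i _ j _ h => ?_) ?_
  · rw [Finset.mem_filter] at hj ⊢
    exact ⟨Finset.mem_univ _, by rw [cellValue, hj.2]⟩
  · simpa using h
  · rintro (⟨s', r', j⟩ | x) hx <;> rw [Finset.mem_filter] at hx
    · simp only [cellValue, Finset.mem_univ, true_and, Sum.inl.injEq, Prod.mk.injEq] at hx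
      obtain ⟨rfl, rfl, hw⟩ := hx
      exact ⟨j, by simpa using hw, rfl⟩
    · simp [cellValue] at hx

lemma card_cellValue_eq_inr_le (δ : ZMod k) (u : Fin m → ZeroSum k) (x : Fin t) :
    (Finset.univ.filter (fun y : Cell k m t => cellValue δ u y = .inr x)).card ≤ 1 := by
  rw [Finset.card_le_one]
  rintro (⟨s, r, j⟩ | y) hy (⟨s', r', j'⟩ | z) hz <;> rw [Finset.mem_filter] at hy hz <;>
    simp_all [cellValue]

lemma occ_hardInput_le (e : Cell k m t ≃ Fin n) (δ : ZMod k) (π : Fin n ≃ Cell k m t)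
    (u : Fin m → ZeroSum k) (v : ℤ) : occ (hardInput e δ π u) v ≤ k := by
  by_cases hv : v ∈ Set.range (label e)
  · obtain ⟨c, rfl⟩ := hv
    rw [occ_hardInput_label]
    rcases c with ⟨s, r, w⟩ | x
    · rw [card_cellValue_eq_inl]
      exact (Finset.card_filter_le _ _).trans (by simp [ZMod.card])
    · exact (card_cellValue_eq_inr_le δ u x).trans (Nat.one_le_iff_ne_zero.2 (NeZero.ne k))
  · simp [occ_hardInput_of_notMem_range e δ π u hv]

lemma isInput_hardInput (e : Cell k m t ≃ Fin n) (δ : ZMod k) (π : Fin n ≃ Cell k m t)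
    (u : Fin m → ZeroSum k) : IsInput k (hardInput e δ π u) := by
  refine ⟨fun i => ?_, occ_hardInput_le e δ π u⟩
  simp only [hardInput, label, Function.comp_apply]
  have := (e (cellValue δ u (π i))).isLt
  omega

lemma occurrenceFree_hardInput_one (hk : 2 ≤ k) (e : Cell k m t ≃ Fin n)
    (π : Fin n ≃ Cell k m t) (u : Fin m → ZeroSum k) :
    OccurrenceFree k (hardInput e 1 π u) := by
  intro v hocc
  by_cases hv : v ∈ Set.range (label e)
  · obtain ⟨c, rfl⟩ := hv
    rw [occ_hardInput_label] at hocc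
    rcases c with ⟨s, r, w⟩ | x
    · rw [card_cellValue_eq_inl] at hocc
      have hall : ∀ j, r.1 j + (u s).1 j + (if j = 0 then (1 : ZMod k) else 0) = w := by
        have := (Finset.card_filter_eq_iff (s := Finset.univ) (p := fun j : ZMod k =>
          r.1 j + (u s).1 j + (if j = 0 then (1 : ZMod k) else 0) = w)).1
            (by rw [hocc, Finset.card_univ, ZMod.card])
        exact fun j => this j (Finset.mem_univ j)
      -- Summing over all roles gives `1 = k * w = 0` in `ZMod k`.
      have hsum := Finset.sum_congr (rfl : (Finset.univ : Finset (ZMod k)) = _)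
        (fun j _ => hall j)
      rw [Finset.sum_add_distrib, Finset.sum_add_distrib, r.2, (u s).2] at hsum
      have : Fact (1 < k) := ⟨hk⟩
      simp [ZMod.card] at hsum
    · have := card_cellValue_eq_inr_le (t := t) (1 : ZMod k) u x
      omega
  · rw [occ_hardInput_of_notMem_range e 1 π u hv] at hocc
    omega

/-- For `δ = 0` every superblock contains a constant block, namely `r = -u s`. -/
lemma occ_hardInput_zero (e : Cell k m t ≃ Fin n) (π : Fin n ≃ Cell k m t)
    (u : Fin m → ZeroSum k) (s : Fin m) :
    occ (hardInput e 0 π u)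
      (label e (.inl (s, ⟨fun j => -(u s).1 j, by simp [(u s).2]⟩, 0))) = k := by
  rw [occ_hardInput_label, card_cellValue_eq_inl]
  simp [ZMod.card]

/-- Changing one entry affects the number of occurrences of at most two values. -/
lemma card_le_two_mul_hammingDist {A B : Fin n → ℤ} (V : Finset ℤ)
    (hV : ∀ v ∈ V, occ A v ≠ occ B v) : V.card ≤ 2 * hammingDist A B := by
  classical
  set D : Finset (Fin n) := Finset.univ.filter (fun i => A i ≠ B i) with hD
  have hsub : V ⊆ D.image A ∪ D.image B := by
    intro v hv
    by_contra hnot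
    simp only [Finset.mem_union, Finset.mem_image, not_or, not_exists, not_and] at hnot
    refine hV v hv (congrArg Finset.card (Finset.filter_congr fun i _ => ?_))
    by_cases hi : A i = B i
    · rw [hi]
    · have hiD : i ∈ D := by simp [hD, hi]
      exact ⟨fun h => (hnot.1 i hiD h).elim, fun h => (hnot.2 i hiD h).elim⟩
  calc V.card ≤ (D.image A ∪ D.image B).card := Finset.card_le_card hsub
    _ ≤ (D.image A).card + (D.image B).card := Finset.card_union_le _ _
    _ ≤ D.card + D.card := add_le_add Finset.card_image_le Finset.card_image_le
    _ = 2 * hammingDist A B := by rw [hD, hammingDist]; ring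

lemma isFar_hardInput_zero (e : Cell k m t ≃ Fin n) (π : Fin n ≃ Cell k m t)
    (u : Fin m → ZeroSum k) {ε : ℝ} (hε : 2 * (ε * n) < m) :
    IsFar k ε (hardInput e 0 π u) := by
  intro B hB
  set f : Fin m → ℤ :=
    fun s => label e (.inl (s, ⟨fun j => -(u s).1 j, by simp [(u s).2]⟩, 0)) with hf
  have hfinj : Function.Injective f := by
    intro s s' h
    have := label_injective e h
    simp only [Sum.inl.injEq, Prod.mk.injEq] at this
    exact this.1
  have key := card_le_two_mul_hammingDist (A := hardInput e 0 π u) (B := B)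
    (Finset.univ.image f) (by
      intro v hv
      obtain ⟨s, -, rfl⟩ := Finset.mem_image.1 hv
      rw [hf, occ_hardInput_zero]
      exact (hB _).symm)
  rw [Finset.card_image_of_injective _ hfinj, Finset.card_univ, Fintype.card_fin] at key
  have : (m : ℝ) ≤ 2 * (hammingDist (hardInput e 0 π u) B : ℝ) := by exact_mod_cast key
  linarith

end HardInputs

/-! ### Coupling the two families of hard inputs -/

section Coupling

variable {k : ℕ} [NeZero k] {n m t : ℕ}

/-- The queries at `Q` reach all `k` roles of some superblock. -/
def Exhausts (π : Fin n ≃ Cell k m t) (Q : Finset (Fin n)) : Prop :=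
  ∃ s : Fin m, ∀ j : ZMod k, ∃ r : ZeroSum k, (.inl (s, r, j) : Cell k m t) ∈ Q.image π

open Classical in
/-- A role in the superblock `s` that the queries at `Q` do not reach, if there is one. -/
noncomputable def freeRole (π : Fin n ≃ Cell k m t) (Q : Finset (Fin n)) (s : Fin m) : ZMod k :=
  if h : ∃ j : ZMod k, ∀ r : ZeroSum k, (.inl (s, r, j) : Cell k m t) ∉ Q.image π then h.choose
  else 0

lemma freeRole_spec {π : Fin n ≃ Cell k m t} {Q : Finset (Fin n)} (h : ¬ Exhausts π Q)
    (s : Fin m) (r : ZeroSum k) : (.inl (s, r, freeRole π Q s) : Cell k m t) ∉ Q.image π := by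
  have hs : ∃ j : ZMod k, ∀ r : ZeroSum k, (.inl (s, r, j) : Cell k m t) ∉ Q.image π := by
    simp only [Exhausts, not_exists, not_forall] at h
    exact h s
  rw [freeRole, dif_pos hs]
  exact hs.choose_spec r

/-- Moves one unit from the role `J s` to the role `0` in each superblock. -/
def moveUnit (J : Fin m → ZMod k) (u : Fin m → ZeroSum k) : Fin m → ZeroSum k := fun s =>
  ⟨fun j => (u s).1 j + (if j = 0 then 1 else 0) - (if j = J s then 1 else 0), by
    rw [Finset.sum_sub_distrib, Finset.sum_add_distrib, (u s).2]
    simp⟩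

lemma moveUnit_injective (J : Fin m → ZMod k) :
    Function.Injective (moveUnit J : (Fin m → ZeroSum k) → Fin m → ZeroSum k) := by
  intro u v h
  funext s
  apply Subtype.ext
  funext j
  have := congrFun (congrArg Subtype.val (congrFun h s)) j
  simpa [moveUnit] using this

lemma cellValue_moveUnit (J : Fin m → ZMod k) (u : Fin m → ZeroSum k) {c : Cell k m t}
    (hc : ∀ s r, c ≠ .inl (s, r, J s)) :
    cellValue 0 (moveUnit J u) c = cellValue 1 u c := by
  rcases c with ⟨s, r, j⟩ | x
  · have hj : j ≠ J s := fun h => hc s r (by rw [h])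
    simp [cellValue, moveUnit, hj, add_assoc]
  · rfl

/-- Unless all roles of some superblock are reached, the run on the `1`-input with shift `u` is
also the run on a `0`-input, whose shift is obtained by moving a unit away from roles that are not
read. -/
lemma run_hardInput_moveUnit (e : Cell k m t ≃ Fin n) (T : QueryTree n)
    (π : Fin n ≃ Cell k m t) (u : Fin m → ZeroSum k)
    (h : ¬ Exhausts π (T.queried (hardInput e 1 π u))) :
    let B := hardInput e 0 π (moveUnit (freeRole π (T.queried (hardInput e 1 π u))) u)
    T.eval (hardInput e 1 π u) = T.eval B ∧
      T.queried (hardInput e 1 π u) = T.queried B := by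
  refine T.eval_and_queried_congr fun i hi => ?_
  simp only [hardInput, Function.comp_apply]
  rw [cellValue_moveUnit]
  intro s r hsr
  exact freeRole_spec h s r (hsr ▸ Finset.mem_image_of_mem π hi)

open Classical in
/-- The acceptance probabilities on the two families differ by at most the probability that
all roles of some superblock are reached. -/
lemma card_accept_one_le (e : Cell k m t ≃ Fin n) (T : QueryTree n) :
    (Finset.univ.filter (fun x : (Fin n ≃ Cell k m t) × (Fin m → ZeroSum k) =>
        T.eval (hardInput e 1 x.1 x.2) = true)).card ≤
      (Finset.univ.filter (fun x : (Fin n ≃ Cell k m t) × (Fin m → ZeroSum k) =>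
        T.eval (hardInput e 0 x.1 x.2) = true)).card +
      (Finset.univ.filter (fun x : (Fin n ≃ Cell k m t) × (Fin m → ZeroSum k) =>
        Exhausts x.1 (T.queried (hardInput e 1 x.1 x.2)))).card := by
  set bad := fun x : (Fin n ≃ Cell k m t) × (Fin m → ZeroSum k) =>
    Exhausts x.1 (T.queried (hardInput e 1 x.1 x.2)) with hbad
  set acc := Finset.univ.filter (fun x : (Fin n ≃ Cell k m t) × (Fin m → ZeroSum k) =>
        T.eval (hardInput e 1 x.1 x.2) = true) with hacc
  rw [← Finset.card_filter_add_card_filter_not (s := acc) (fun x => ¬ bad x)]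
  refine add_le_add ?_ (Finset.card_le_card fun x hx => ?_)
  · refine Finset.card_le_card_of_injOn
      (fun x => (x.1, moveUnit (freeRole x.1 (T.queried (hardInput e 1 x.1 x.2))) x.2))
      (fun x hx => ?_) ?_
    · simp only [hacc, Finset.coe_filter, Finset.mem_filter, Finset.mem_univ, true_and,
        Set.mem_ofPred_eq] at hx ⊢
      rw [← (run_hardInput_moveUnit e T x.1 x.2 hx.2).1]
      exact hx.1
    · rintro ⟨π, u⟩ hx ⟨ρ, v⟩ hy hxy
      simp only [hacc, Finset.coe_filter, Finset.mem_filter, Finset.mem_univ, true_and,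
        Set.mem_ofPred_eq, hbad] at hx hy
      simp only [Prod.mk.injEq] at hxy
      obtain ⟨rfl, huv⟩ := hxy
      have hQ : T.queried (hardInput e 1 π u) = T.queried (hardInput e 1 π v) := by
        rw [(run_hardInput_moveUnit e T π u hx.2).2, (run_hardInput_moveUnit e T π v hy.2).2, huv]
      rw [hQ] at huv
      rw [moveUnit_injective _ huv]
  · simp only [Finset.mem_filter, Finset.mem_univ, true_and, not_not] at hx ⊢
    exact hx.2

open Classical in
/-- The union bound over the superblock and over the blocks from which its `k` roles are reached. -/
lemma card_exhausts_mul_pow_le (e : Cell k m t ≃ Fin n) (T : QueryTree n) {q b : ℕ}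
    (hbq : b + q ≤ n) (hq : ∀ A, IsInput k A → T.queries A ≤ q) :
    (Finset.univ.filter (fun x : (Fin n ≃ Cell k m t) × (Fin m → ZeroSum k) =>
        Exhausts x.1 (T.queried (hardInput e 1 x.1 x.2)))).card * b ^ k ≤
      m * Fintype.card (ZeroSum k) ^ k * q ^ k *
        Fintype.card ((Fin n ≃ Cell k m t) × (Fin m → ZeroSum k)) := by
  -- One cell of each role in the superblock `s`, taken from the blocks `f`.
  let X : Fin m × (ZMod k → ZeroSum k) → Finset (Cell k m t) :=
    fun y => Finset.univ.image (fun j => .inl (y.1, y.2 j, j))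
  have hX : ∀ y, (X y).card = k := fun y => by
    rw [Finset.card_image_of_injective, Finset.card_univ, ZMod.card]
    intro i j h
    simp only [Sum.inl.injEq, Prod.mk.injEq] at h
    exact h.2.2
  have hone : ∀ (u : Fin m → ZeroSum k) (y : Fin m × (ZMod k → ZeroSum k)),
      (Finset.univ.filter (fun π : Fin n ≃ Cell k m t =>
        X y ⊆ (T.queried (hardInput e 1 π u)).image π)).card * b ^ k ≤
        q ^ k * Fintype.card (Fin n ≃ Cell k m t) := by
    intro u y
    have hext : extensions (∅ : Finset (Fin n)) (fun i => e.symm i) = Finset.univ := by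
      simp [extensions]
    have := card_hitting_le (by simpa using Fintype.card_congr e) (label e ∘ cellValue 1 u) b T ∅
      (fun i => e.symm i) (X y) q (by simp) (by simpa using hbq)
      (fun π _ => hq _ (isInput_hardInput e 1 π u))
    rwa [hext, hX, Finset.card_univ] at this
  have hcover : (Finset.univ.filter (fun x : (Fin n ≃ Cell k m t) × (Fin m → ZeroSum k) =>
        Exhausts x.1 (T.queried (hardInput e 1 x.1 x.2)))) ⊆
      (Finset.univ : Finset ((Fin m → ZeroSum k) × (Fin m × (ZMod k → ZeroSum k)))).biUnion
        (fun z => (Finset.univ.filter (fun π : Fin n ≃ Cell k m t =>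
          X z.2 ⊆ (T.queried (hardInput e 1 π z.1)).image π)).image (fun π => (π, z.1))) := by
    rintro ⟨π, u⟩ hx
    simp only [Finset.mem_filter, Finset.mem_univ, true_and] at hx
    obtain ⟨s, hs⟩ := hx
    choose f hf using hs
    simp only [Finset.mem_biUnion, Finset.mem_univ, true_and]
    refine ⟨(u, s, f), Finset.mem_image.2 ⟨π, Finset.mem_filter.2 ⟨Finset.mem_univ _, ?_⟩, rfl⟩⟩
    intro c hc
    obtain ⟨j, -, rfl⟩ := Finset.mem_image.1 hc
    exact hf j
  calc _ ≤ (∑ z : (Fin m → ZeroSum k) × (Fin m × (ZMod k → ZeroSum k)),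
          (Finset.univ.filter (fun π : Fin n ≃ Cell k m t =>
            X z.2 ⊆ (T.queried (hardInput e 1 π z.1)).image π)).card) * b ^ k := by
        refine Nat.mul_le_mul_right _ ((Finset.card_le_card hcover).trans
          (Finset.card_biUnion_le.trans (Finset.sum_le_sum fun z _ => Finset.card_image_le)))
    _ ≤ ∑ _z : (Fin m → ZeroSum k) × (Fin m × (ZMod k → ZeroSum k)),
          q ^ k * Fintype.card (Fin n ≃ Cell k m t) := by
        rw [Finset.sum_mul]
        exact Finset.sum_le_sum fun z _ => hone z.1 z.2
    _ = _ := by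
        rw [Finset.sum_const, Finset.card_univ, Fintype.card_prod, Fintype.card_prod,
          Fintype.card_fin, Fintype.card_fun (α := ZMod k), ZMod.card, Fintype.card_prod,
          smul_eq_mul]
        ring

end Coupling

/-! ### Averaging over the seed -/

section Averaging

open Classical in
/-- The easy half of Yao's principle: if for every seed the algorithm accepts at most `D` more
members of the family `F` than of the family `G`, then the same holds for the sums of its acceptance
probabilities. -/
lemma sum_measureReal_accept_le {n : ℕ} {Ω : Type*} [MeasurableSpace Ω] (μ : Measure Ω)
    [IsProbabilityMeasure μ] (T : RandomizedAlgorithm n Ω) {ι : Type*} [Fintype ι]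
    (F G : ι → Fin n → ℤ) (D : ℝ)
    (h : ∀ ω, ((Finset.univ.filter (fun x => (T.tree ω).eval (F x) = true)).card : ℝ) ≤
      (Finset.univ.filter (fun x => (T.tree ω).eval (G x) = true)).card + D) :
    ∑ x, μ.real {ω | (T.tree ω).eval (F x) = true} ≤
      ∑ x, μ.real {ω | (T.tree ω).eval (G x) = true} + D := by
  have hint : ∀ A : Fin n → ℤ, Integrable
      ({ω | (T.tree ω).eval A = true}.indicator (fun _ => (1 : ℝ))) μ := fun A =>
    (integrable_const 1).indicator (T.measurableSet_accept A)
  have hind : ∀ H : ι → Fin n → ℤ,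
      (fun ω => ((Finset.univ.filter (fun x => (T.tree ω).eval (H x) = true)).card : ℝ)) =
        fun ω => ∑ x, {ω | (T.tree ω).eval (H x) = true}.indicator (fun _ => (1 : ℝ)) ω := by
    intro H
    funext ω
    rw [Finset.card_filter]
    push_cast
    exact Finset.sum_congr rfl fun x _ => by simp [Set.indicator_apply]
  have hsum : ∀ H : ι → Fin n → ℤ, ∑ x, μ.real {ω | (T.tree ω).eval (H x) = true} =
      ∫ ω, ((Finset.univ.filter (fun x => (T.tree ω).eval (H x) = true)).card : ℝ) ∂μ := by
    intro H
    rw [hind, integral_finsetSum _ fun x _ => hint (H x)]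
    refine Finset.sum_congr rfl fun x _ => ?_
    rw [integral_indicator_const _ (T.measurableSet_accept _)]
    simp
  have hcard : ∀ H : ι → Fin n → ℤ, Integrable
      (fun ω => ((Finset.univ.filter (fun x => (T.tree ω).eval (H x) = true)).card : ℝ)) μ := by
    intro H
    rw [hind]
    exact integrable_finsetSum _ fun x _ => hint (H x)
  rw [hsum F, hsum G]
  calc _ ≤ ∫ ω, (((Finset.univ.filter
            (fun x => (T.tree ω).eval (G x) = true)).card : ℝ) + D) ∂μ :=
        integral_mono (hcard F) ((hcard G).add (integrable_const D)) h
    _ = _ := by rw [integral_add (hcard G) (integrable_const D)]; simp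

lemma measureReal_accept_le {n : ℕ} {Ω : Type*} [MeasurableSpace Ω] (μ : Measure Ω)
    [IsProbabilityMeasure μ] (T : RandomizedAlgorithm n Ω) (A : Fin n → ℤ)
    (h : 2 / 3 ≤ μ.real {ω | (T.tree ω).eval A = false}) :
    μ.real {ω | (T.tree ω).eval A = true} ≤ 1 / 3 := by
  have hcompl : {ω | (T.tree ω).eval A = false} = {ω | (T.tree ω).eval A = true}ᶜ := by
    ext ω
    simp
  rw [hcompl, probReal_compl_eq_one_sub (T.measurableSet_accept A)] at h
  linarith

end Averaging

/-- A tester has to reach all roles of some superblock with probability at least `1 / 3` over the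
hard inputs, and the right-hand side is the union bound for this probability when at least `b`
positions are never queried. -/
lemma one_third_le_of_isTester {k : ℕ} [NeZero k] (hk : 2 ≤ k) {n m t : ℕ}
    (e : Cell k m t ≃ Fin n) {ε : ℝ} (hε : 2 * (ε * n) < m) {Ω : Type*} [MeasurableSpace Ω]
    (μ : Measure Ω) [IsProbabilityMeasure μ] (T : RandomizedAlgorithm n Ω) {q b : ℕ}
    (hb : 0 < b) (hbq : b + q ≤ n) (hT : IsTester k ε μ T) (hq : MakesAtMost k T q) :
    (1 / 3 : ℝ) ≤ m * (Fintype.card (ZeroSum k) * q / b : ℝ) ^ k := by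
  classical
  set I := (Fin n ≃ Cell k m t) × (Fin m → ZeroSum k)
  have hI : 0 < (Fintype.card I : ℝ) := by
    have : Nonempty I := ⟨(e.symm, fun _ => ⟨fun _ => 0, by simp⟩)⟩
    exact_mod_cast Fintype.card_pos
  set D : ℝ := m * (Fintype.card (ZeroSum k) * q / b : ℝ) ^ k * Fintype.card I with hD
  have hb' : (0 : ℝ) < (b : ℝ) ^ k := by positivity
  have key := sum_measureReal_accept_le μ T (fun x : I => hardInput e 1 x.1 x.2)
    (fun x : I => hardInput e 0 x.1 x.2) D (fun ω => by
      have h1 := card_accept_one_le e (T.tree ω)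
      have h2 := card_exhausts_mul_pow_le e (T.tree ω) hbq (fun A hA => hq A hA ω)
      set N := (Finset.univ.filter (fun x : I =>
        Exhausts x.1 ((T.tree ω).queried (hardInput e 1 x.1 x.2)))).card
      have h3 : (N : ℝ) ≤ D := by
        have h2' : (N : ℝ) * (b : ℝ) ^ k ≤
            m * (Fintype.card (ZeroSum k) : ℝ) ^ k * (q : ℝ) ^ k * Fintype.card I := by
          exact_mod_cast h2
        rw [← le_div_iff₀ hb'] at h2'
        refine h2'.trans_eq ?_
        rw [hD, div_pow, mul_pow]
        ring
      have h1' := (Nat.cast_le (α := ℝ)).2 h1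
      push_cast at h1'
      linarith)
  have hF : (Fintype.card I : ℝ) * (2 / 3) ≤
      ∑ x : I, μ.real {ω | (T.tree ω).eval (hardInput e 1 x.1 x.2) = true} := by
    rw [← nsmul_eq_mul]
    exact Finset.card_nsmul_le_sum _ _ _ fun x _ =>
      hT.1 _ (isInput_hardInput e 1 x.1 x.2) (occurrenceFree_hardInput_one hk e x.1 x.2)
  have hG : ∑ x : I, μ.real {ω | (T.tree ω).eval (hardInput e 0 x.1 x.2) = true} ≤
      Fintype.card I * (1 / 3) := by
    rw [← nsmul_eq_mul]
    exact Finset.sum_le_card_nsmul _ _ _ fun x _ => measureReal_accept_le μ T _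
      (hT.2 _ (isInput_hardInput e 0 x.1 x.2) (isFar_hardInput_zero e x.1 x.2 hε))
  have : (Fintype.card I : ℝ) * (1 / 3) ≤
      Fintype.card I * (m * (Fintype.card (ZeroSum k) * q / b : ℝ) ^ k) := by
    rw [hD] at key
    linarith
  exact le_of_mul_le_mul_left this hI

end SequenceTesting

theorem theorem3 (k : ℕ) (hk : 2 ≤ k) :
    ∃ ε₀ : ℝ, 0 < ε₀ ∧ ∃ c : ℝ, 0 < c ∧ ∃ n₀ : ℕ, ∀ n : ℕ, n₀ ≤ n →
      ∀ ε : ℝ, 0 < ε → ε ≤ ε₀ →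
        ∀ (Ω : Type*) [MeasurableSpace Ω] (μ : MeasureTheory.Measure Ω)
          [MeasureTheory.IsProbabilityMeasure μ]
          (T : SequenceTesting.RandomizedAlgorithm n Ω) (q : ℕ),
          SequenceTesting.IsTester k ε μ T → SequenceTesting.MakesAtMost k T q →
            c * (n : ℝ) ^ (1 - 1 / (k : ℝ)) ≤ (q : ℝ) := by
  have : NeZero k := ⟨by omega⟩
  set R := Fintype.card (SequenceTesting.ZeroSum k) with hR
  have hRpos : 0 < R := Fintype.card_pos_iff.2 ⟨⟨fun _ => 0, by simp⟩⟩
  have hR1 : (1 : ℝ) ≤ R := by exact_mod_cast hRpos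
  set K := R * k with hK
  have hKpos : 0 < K := by positivity
  have hK1 : (1 : ℝ) ≤ K := by exact_mod_cast hKpos
  refine ⟨1 / (8 * K), by positivity, 1 / (6 * R), by positivity, K, ?_⟩
  intro n hn ε hε hε₀ Ω _ μ _ T q hT hq
  by_contra! hlt
  set m := n / K
  have hm : 0 < m := Nat.div_pos hn hKpos
  have hdiv : K * m + n % K = n := Nat.div_add_mod n K
  have hmod : n % K < K := Nat.mod_lt n hKpos
  have hnpos : (0 : ℝ) < n := by exact_mod_cast hKpos.trans_le hn
  have hn1 : (1 : ℝ) ≤ n := by exact_mod_cast hKpos.trans_le hn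
  have e : SequenceTesting.Cell k m (n % K) ≃ Fin n := Fintype.equivFinOfCardEq (by
    rw [Fintype.card_sum, Fintype.card_prod, Fintype.card_prod, Fintype.card_fin,
      Fintype.card_fin, ZMod.card, ← hR, ← hK, mul_comm m K, hdiv])
  have hmn : (n : ℝ) < 2 * K * m := by
    have : n < 2 * K * m := by nlinarith
    exact_mod_cast this
  have hmn' : (m : ℝ) ≤ n := by exact_mod_cast Nat.div_le_self n K
  have hfar : 2 * (ε * n) < m := by
    have h1 : ε * n ≤ 1 / (8 * K) * n := by gcongr
    have h2 : 1 / (8 * K) * (n : ℝ) ≤ 1 / (8 * K) * (2 * K * m) := by gcongr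
    have h3 : 1 / (8 * K) * (2 * K * m : ℝ) = m / 4 := by field_simp; norm_num
    have h4 : (0 : ℝ) < m := by exact_mod_cast hm
    linarith
  have hk' : (0 : ℝ) < k := by positivity
  -- As `R ≥ 1`, fewer than `n / 6` positions are queried, and at least `n / 2` stay unexposed.
  have hqn : (q : ℝ) < n / 6 := by
    refine hlt.trans_le ?_
    have h1 : (n : ℝ) ^ (1 - 1 / (k : ℝ)) ≤ n := by
      calc (n : ℝ) ^ (1 - 1 / (k : ℝ)) ≤ (n : ℝ) ^ (1 : ℝ) :=
            Real.rpow_le_rpow_of_exponent_le hn1 (by have := one_div_pos.2 hk'; linarith)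
        _ = n := Real.rpow_one _
    have h2 : 1 / (6 * (R : ℝ)) ≤ 1 / 6 := by
      apply one_div_le_one_div_of_le <;> linarith
    calc 1 / (6 * (R : ℝ)) * (n : ℝ) ^ (1 - 1 / (k : ℝ)) ≤ 1 / 6 * n := by gcongr
      _ = n / 6 := by ring
  have hqn' : q ≤ n := by
    have : (q : ℝ) ≤ n := by linarith
    exact_mod_cast this
  have hb : (n : ℝ) / 2 ≤ ((n - q : ℕ) : ℝ) := by
    rw [Nat.cast_sub hqn']
    linarith
  have hb0 : 0 < n - q := by
    have : (0 : ℝ) < ((n - q : ℕ) : ℝ) := by linarith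
    exact_mod_cast this
  have key := SequenceTesting.one_third_le_of_isTester hk e hfar μ T hb0 (by omega) hT hq
  have hle : (R * q / ((n - q : ℕ) : ℝ) : ℝ) ≤ 1 / 3 * (n : ℝ) ^ (-(1 / (k : ℝ))) := by
    calc (R * q / ((n - q : ℕ) : ℝ) : ℝ)
        ≤ R * (1 / (6 * R) * (n : ℝ) ^ (1 - 1 / (k : ℝ))) / (n / 2) := by gcongr
      _ = 1 / 3 * ((n : ℝ) ^ (1 - 1 / (k : ℝ)) / n) := by field_simp; norm_num
      _ = 1 / 3 * (n : ℝ) ^ (-(1 / (k : ℝ))) := by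
          rw [← Real.rpow_sub_one hnpos.ne']
          ring_nf
  have hpow : ((n : ℝ) ^ (-(1 / (k : ℝ)))) ^ k = (n : ℝ)⁻¹ := by
    rw [← Real.rpow_natCast, ← Real.rpow_mul hnpos.le, ← Real.rpow_neg_one]
    congr 1
    field_simp
  have : (m : ℝ) * (R * q / ((n - q : ℕ) : ℝ) : ℝ) ^ k ≤ 1 / 9 := by
    calc (m : ℝ) * (R * q / ((n - q : ℕ) : ℝ) : ℝ) ^ k
        ≤ n * (1 / 3 * (n : ℝ) ^ (-(1 / (k : ℝ)))) ^ k := by gcongr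
      _ = (1 / 3 : ℝ) ^ k := by rw [mul_pow, hpow]; field_simp
      _ ≤ (1 / 3 : ℝ) ^ 2 := pow_le_pow_of_le_one (by norm_num) (by norm_num) hk
      _ = 1 / 9 := by norm_num
  linarith
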